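/- Let $n\ge 0$ and let $h\in\mathbb{R}[x]=\mathbb{R}[x_1,\dots,x_n]$ be a finite product (possibly empty, in which case $h=1$) of irreducible polynomials $p$, each of which is real, i.e. there are $u,v\in\mathbb{R}^n$ with $p(u)<0<p(v)$. Let $A=\mathbb{R}[x,h^{-1}]$ be the localization of $\mathbb{R}[x]$ at the powers of $h$. Let $\Sigma A^2$ be the set of all finite sums of squares of elements of $A$, let $\widehat A$ be the set of unital $\mathbb{R}$-algebra homomorphisms $\chi\colon A\to\mathbb{R}$ with the topology of pointwise convergence, and let $A_+=\{a\in A:\chi(a)\ge 0\text{ for all }\chi\in\widehat A\}$. (a) $\Sigma A^2$ is closed in the finest locally convex topology of the real vector space $A$. (b) If $n\ge 2$, then $A$ does not have the moment property: not every linear functional $L\colon A\to\mathbb{R}$ with $L(f^2)\ge 0$ for all $f\in A$ is of the form $L(f)=\int_{\widehat A}\chi(f)\,d\mu(\chi)$ $(f\in A)$ for a (positive) Radon measure $\mu$ on $\widehat A$ with respect to which all functions $\chi\mapsto\chi(f)$, $f\in A$, are integrable. Moreover, for all indices $i\ne j$ the Motzkin polynomial $x_i^4x_j^2+x_i^2x_j^4-3x_i^2x_j^2+1$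 lies in $A_+$ but not in $\Sigma A^2$. -/

import Mathlib

open scoped Topology

noncomputable section

/-- A real irreducible polynomial: irreducible over `ℝ`, and strictly negative at some point
of `ℝⁿ` and strictly positive at some other point. -/
def IsRealIrreducible {n : ℕ} (p : MvPolynomial (Fin n) ℝ) : Prop :=
  Irreducible p ∧
    ∃ u v : Fin n → ℝ, MvPolynomial.eval u p < 0 ∧ 0 < MvPolynomial.eval v p

/-- The algebra of fractions `ℝ[x₁, …, xₙ, h⁻¹]`. -/
abbrev FractionAlgebra {n : ℕ} (h : MvPolynomial (Fin n) ℝ) : Type :=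
  Localization.Away h

/-- The finest locally convex topology on a real vector space: the infimum (in Mathlib's order
`t ≤ s` means that `t` is finer than `s`) of all locally convex vector space topologies. -/
abbrev finestLocallyConvexTopology (E : Type*) [AddCommGroup E] [Module ℝ E] :
    TopologicalSpace E :=
  sInf {t : TopologicalSpace E |
    @IsTopologicalAddGroup E t _ ∧ @ContinuousSMul ℝ E _ _ t ∧ @LocallyConvexSpace ℝ E _ _ _ _ t}

/-- The sos cone: all finite sums of squares. -/
def sosCone (B : Type*) [CommRing B] : Set B :=
  {b | IsSumSq b}

/-- The set of characters (unital algebra homomorphisms to `ℝ`) of a real algebra. -/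
def RealCharacter (B : Type*) [CommRing B] [Algebra ℝ B] : Type _ :=
  B →ₐ[ℝ] ℝ

namespace RealCharacter

variable {B : Type*} [CommRing B] [Algebra ℝ B]

instance : CoeFun (RealCharacter B) (fun _ => B → ℝ) :=
  ⟨fun χ => (show B →ₐ[ℝ] ℝ from χ)⟩

/-- The topology of pointwise convergence. When `B` is generated by `b₁, …, b_d`, it is the one
induced by the embedding `χ ↦ (χ b₁, …, χ b_d)` into `ℝ^d`. -/
instance : TopologicalSpace (RealCharacter B) :=
  TopologicalSpace.induced (fun χ : RealCharacter B => fun b : B => χ b) inferInstance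

instance : MeasurableSpace (RealCharacter B) := borel _

instance : BorelSpace (RealCharacter B) := ⟨rfl⟩

end RealCharacter

/-- The positive semidefinite elements: those that are nonnegative at every character. -/
def psdCone (B : Type*) [CommRing B] [Algebra ℝ B] : Set B :=
  {b | ∀ χ : RealCharacter B, 0 ≤ χ b}

/-- `L` is integration against a positive Radon measure on the space of characters. -/
def IsMomentFunctional {B : Type*} [CommRing B] [Algebra ℝ B] (L : B →ₗ[ℝ] ℝ) : Prop :=
  ∃ μ : MeasureTheory.Measure (RealCharacter B),
    MeasureTheory.IsFiniteMeasureOnCompacts μ ∧ μ.InnerRegular ∧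
      ∀ f : B, MeasureTheory.Integrable (fun χ : RealCharacter B => χ f) μ ∧
        L f = ∫ χ : RealCharacter B, χ f ∂μ

/-- The moment property: every linear functional that is nonnegative on squares is a moment
functional. -/
def HasMomentProperty (B : Type*) [CommRing B] [Algebra ℝ B] : Prop :=
  ∀ L : B →ₗ[ℝ] ℝ, (∀ f : B, 0 ≤ L (f ^ 2)) → IsMomentFunctional L

/-- The Motzkin polynomial `xᵢ⁴ xⱼ² + xᵢ² xⱼ⁴ - 3 xᵢ² xⱼ² + 1` in two of the variables. -/
def motzkinPolynomial {n : ℕ} (i j : Fin n) : MvPolynomial (Fin n) ℝ :=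
  MvPolynomial.X i ^ 4 * MvPolynomial.X j ^ 2 + MvPolynomial.X i ^ 2 * MvPolynomial.X j ^ 4
    - 3 * MvPolynomial.X i ^ 2 * MvPolynomial.X j ^ 2 + 1

end

/-! Everything reduces to sums of squares in `ℝ[x]`. A sign-changing irreducible `p` divides every
polynomial that vanishes on its real zeros (`IsRealIrreducible.dvd_of_eval_eq_zero`). If `p` divides
`∑ qᵢ²`, then each `qᵢ` vanishes there, so `p` divides each `qᵢ`, and `p²` can be cancelled from
sums of squares. This passes to products, so a polynomial that is a sum of squares in `A` is already
one in `ℝ[x]` (`CancelsSumSq.isSumSq_algebraMap_iff`).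

For (a), `A` has countable dimension, so closedness need only be tested on finitely parametrized
affine families (`isClosed_finestLocallyConvexTopology`). Multiplying such a family by the square of
a unit moves it into `ℝ[x]` with bounded degree, where compactness of normalized Gram matrices gives
closedness (`isSumSq_of_tendsto_eval`).

For (b), the Motzkin polynomial is nonnegative but not a sum of squares in `ℝ[x]`, hence not in `A`.
Hahn–Banach separates it from the closed cone by a functional that is nonnegative on squares and
negative at the Motzkin polynomial; no positive measure represents such a functional. -/

/-! ### Sign-changing irreducible polynomials and their real zeros. -/

/-- The shear `x ↦ x + t w`, `t ↦ t` of `ℝ[x][t]`. -/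
noncomputable def shearHom {n : ℕ} (w : Fin n → ℝ) :
    Polynomial (MvPolynomial (Fin n) ℝ) →+* Polynomial (MvPolynomial (Fin n) ℝ) :=
  Polynomial.eval₂RingHom
    (MvPolynomial.aeval (R := ℝ) (S₁ := Polynomial (MvPolynomial (Fin n) ℝ)) fun i =>
      Polynomial.C (MvPolynomial.X i) + Polynomial.C (MvPolynomial.C (w i)) * Polynomial.X
      ).toRingHom
    Polynomial.X

theorem shearHom_X {n : ℕ} (w : Fin n → ℝ) : shearHom w Polynomial.X = Polynomial.X := by
  simp [shearHom]

theorem shearHom_C_C {n : ℕ} (w : Fin n → ℝ) (r : ℝ) :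
    shearHom w (Polynomial.C (MvPolynomial.C r)) = Polynomial.C (MvPolynomial.C r) := by
  simp [shearHom]

theorem shearHom_C_X {n : ℕ} (w : Fin n → ℝ) (i : Fin n) :
    shearHom w (Polynomial.C (MvPolynomial.X i)) =
      Polynomial.C (MvPolynomial.X i) + Polynomial.C (MvPolynomial.C (w i)) * Polynomial.X := by
  simp [shearHom]

theorem shearHom_comp_neg {n : ℕ} (w : Fin n → ℝ) :
    (shearHom w).comp (shearHom (-w)) = RingHom.id _ := by
  refine Polynomial.ringHom_ext' (MvPolynomial.ringHom_ext (fun r => ?_) fun i => ?_) ?_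
  · simp [shearHom_C_C]
  · simp only [RingHom.comp_apply, shearHom_C_X, map_add, map_mul, shearHom_C_C, shearHom_X]
    simp [add_assoc, ← add_mul]
  · simp [shearHom_X]

/-- The shear as a ring automorphism. -/
noncomputable def shearEquiv {n : ℕ} (w : Fin n → ℝ) :
    Polynomial (MvPolynomial (Fin n) ℝ) ≃+* Polynomial (MvPolynomial (Fin n) ℝ) :=
  RingEquiv.ofRingHom (shearHom w) (shearHom (-w)) (shearHom_comp_neg w)
    (by simpa using shearHom_comp_neg (-w))

/-- The polynomial `t ↦ q(x + t w)`. -/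
noncomputable def shearPoly {n : ℕ} (w : Fin n → ℝ) (q : MvPolynomial (Fin n) ℝ) :
    Polynomial (MvPolynomial (Fin n) ℝ) :=
  shearEquiv w (Polynomial.C q)

theorem eval_shearPoly {n : ℕ} (w x : Fin n → ℝ) (t : ℝ) (q : MvPolynomial (Fin n) ℝ) :
    Polynomial.eval₂ (MvPolynomial.eval x) t (shearPoly w q) =
      MvPolynomial.eval (fun i => x i + t * w i) q := by
  have : ((Polynomial.eval₂RingHom (MvPolynomial.eval x) t).comp
      ((shearHom w).comp Polynomial.C)) = MvPolynomial.eval (fun i => x i + t * w i) := by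
    refine MvPolynomial.ringHom_ext (fun r => ?_) fun i => ?_
    · simp [shearHom_C_C]
    · simp only [RingHom.comp_apply, shearHom_C_X]
      simp only [Polynomial.coe_eval₂RingHom, Polynomial.eval₂_add, Polynomial.eval₂_mul,
        Polynomial.eval₂_C, Polynomial.eval₂_X, MvPolynomial.eval_X, MvPolynomial.eval_C]
      ring
  exact congrArg (fun f => f q) this

theorem eval_zero_shearPoly {n : ℕ} (w : Fin n → ℝ) (q : MvPolynomial (Fin n) ℝ) :
    (shearPoly w q).eval 0 = q := by
  have : ((Polynomial.evalRingHom 0).comp ((shearHom w).comp Polynomial.C)) =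
      RingHom.id (MvPolynomial (Fin n) ℝ) := by
    refine MvPolynomial.ringHom_ext (fun r => ?_) fun i => ?_
    · simp [shearHom_C_C]
    · simp only [RingHom.comp_apply, shearHom_C_X]
      simp
  exact congrArg (fun f => f q) this

theorem MvPolynomial.eq_zero_of_eventually_eval_eq_zero {n : ℕ} {d : MvPolynomial (Fin n) ℝ}
    {u : Fin n → ℝ} (hd : ∀ᶠ x in 𝓝 u, MvPolynomial.eval x d = 0) : d = 0 := by
  obtain ⟨ε, hε, hball⟩ := Metric.eventually_nhds_iff_ball.1 hd
  refine MvPolynomial.funext_set (fun i => Metric.ball (u i) ε) (fun i => ?_) fun x hx => ?_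
  · rw [Real.ball_eq_Ioo]
    exact Set.Ioo_infinite (by linarith)
  · rw [map_zero]
    refine hball x ?_
    rw [ball_pi _ hε]
    exact hx

/-- Two polynomials over a factorial domain, the first irreducible of positive degree and not
dividing the second, have a nonzero constant in the ideal they generate. -/
theorem Polynomial.exists_C_eq_of_not_dvd {S : Type*} [CommRing S] [IsDomain S]
    [UniqueFactorizationMonoid S] {P G : Polynomial S} (hP : Irreducible P)
    (hdeg : P.natDegree ≠ 0) (h : ¬ P ∣ G) :
    ∃ d : S, d ≠ 0 ∧ ∃ a b : Polynomial S, a * P + b * G = Polynomial.C d := by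
  classical
  let : NormalizedGCDMonoid S := Classical.choice inferInstance
  let K := FractionRing S
  -- Gauss's lemma carries irreducibility and non-divisibility to `K[t]`, where they give a Bézout
  -- identity; clearing denominators turns its right side `1` into `c * e`.
  have hprim : P.IsPrimitive := hP.isPrimitive hdeg
  have hirr := (hprim.irreducible_iff_irreducible_map_fraction_map (K := K)).1 hP
  have hnd : ¬ P.map (algebraMap S K) ∣ G.map (algebraMap S K) := fun hd =>
    h (hprim.dvd_of_fraction_map_dvd_fraction_map hd)
  obtain ⟨a, b, hab⟩ := (hirr.coprime_iff_not_dvd).2 hnd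
  obtain ⟨c, hc, ha⟩ : ∃ c : S, c ≠ 0 ∧ ∃ A : Polynomial S,
      A.map (algebraMap S K) = c • a :=
    let ⟨c, hc, h⟩ := IsLocalization.integerNormalization_spec (nonZeroDivisors S) a
    ⟨c, nonZeroDivisors.ne_zero hc, _, h⟩
  obtain ⟨e, he, hb⟩ : ∃ e : S, e ≠ 0 ∧ ∃ B : Polynomial S,
      B.map (algebraMap S K) = e • b :=
    let ⟨c, hc, h⟩ := IsLocalization.integerNormalization_spec (nonZeroDivisors S) b
    ⟨c, nonZeroDivisors.ne_zero hc, _, h⟩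
  obtain ⟨A, hA⟩ := ha
  obtain ⟨B, hB⟩ := hb
  refine ⟨c * e, mul_ne_zero hc he, Polynomial.C e * A, Polynomial.C c * B,
    Polynomial.map_injective _ (FaithfulSMul.algebraMap_injective S K) ?_⟩
  simp only [Polynomial.map_add, Polynomial.map_mul, Polynomial.map_C, hA, hB, map_mul,
    Algebra.smul_def, Polynomial.algebraMap_apply] at hab ⊢
  linear_combination (Polynomial.C (algebraMap S K c) * Polynomial.C (algebraMap S K e)) * hab

/-- Along `w = v - u`, the polynomial `p(x + t w)` is irreducible in `ℝ[x][t]` and nonconstant in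
`t`. If `p ∤ g`, some nonzero `d(x)` lies in the ideal generated by `p(x + t w)` and `g(x + t w)`.
For `x` near `u`, `p` changes sign between `x` and `x + w`, so both generators vanish at a common
`t` and `d(x) = 0`. Thus `d` vanishes on an open set, a contradiction. -/
theorem IsRealIrreducible.dvd_of_eval_eq_zero {n : ℕ} {p g : MvPolynomial (Fin n) ℝ}
    (hp : IsRealIrreducible p)
    (hg : ∀ x, MvPolynomial.eval x p = 0 → MvPolynomial.eval x g = 0) : p ∣ g := by
  obtain ⟨hirr, u, v, hu, hv⟩ := hp
  by_contra hpg
  set w : Fin n → ℝ := v - u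
  have hPirr : Irreducible (shearPoly w p) := by
    refine Prime.irreducible ?_
    rw [shearPoly, MulEquiv.prime_iff (shearEquiv w)]
    exact Polynomial.prime_C_iff.2 hirr.prime
  have e0 (x : Fin n → ℝ) (q) : Polynomial.eval₂ (MvPolynomial.eval x) 0 (shearPoly w q) =
      MvPolynomial.eval x q := by
    rw [eval_shearPoly]
    simp
  have hdeg : (shearPoly w p).natDegree ≠ 0 := fun h0 => by
    have h1 := eval_shearPoly w u 1 p
    have h2 := e0 u p
    rw [Polynomial.eq_C_of_natDegree_eq_zero h0, Polynomial.eval₂_C] at h1 h2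
    rw [h2] at h1
    simp only [w, Pi.sub_apply, one_mul, add_sub_cancel] at h1
    linarith
  have hnd : ¬ shearPoly w p ∣ shearPoly w g := fun hd => hpg <| by
    have := map_dvd (Polynomial.evalRingHom 0) hd
    simpa [eval_zero_shearPoly] using this
  obtain ⟨d, hd0, a, b, hab⟩ := Polynomial.exists_C_eq_of_not_dvd hPirr hdeg hnd
  refine hd0 (MvPolynomial.eq_zero_of_eventually_eval_eq_zero (u := u) ?_)
  have hc : Continuous fun x : Fin n → ℝ => MvPolynomial.eval x p :=
    MvPolynomial.continuous_eval p
  have hneg : ∀ᶠ x in 𝓝 u, MvPolynomial.eval x p < 0 := hc.continuousAt.eventually_lt_const hu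
  have hpos : ∀ᶠ x in 𝓝 u, 0 < MvPolynomial.eval (fun i => x i + 1 * w i) p := by
    have h1 : Continuous fun x : Fin n → ℝ => MvPolynomial.eval (fun i => x i + 1 * w i) p :=
      hc.comp (by fun_prop)
    refine h1.continuousAt.eventually_const_lt ?_
    simpa [w] using hv
  filter_upwards [hneg, hpos] with x h1 h2
  have hct : Continuous fun t : ℝ => MvPolynomial.eval (fun i => x i + t * w i) p :=
    hc.comp (by fun_prop)
  obtain ⟨t, -, ht⟩ := intermediate_value_Icc (zero_le_one' ℝ) hct.continuousOn
    (show (0 : ℝ) ∈ Set.Icc _ _ from ⟨by simpa using h1.le, h2.le⟩)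
  replace ht : MvPolynomial.eval (fun i => x i + t * w i) p = 0 := ht
  have := congrArg (Polynomial.eval₂ (MvPolynomial.eval x) t) hab
  rw [Polynomial.eval₂_add, Polynomial.eval₂_mul, Polynomial.eval₂_mul, eval_shearPoly,
    eval_shearPoly, Polynomial.eval₂_C, ht, hg _ ht] at this
  simpa using this.symm

/-! ### Cancelling denominators from sums of squares. -/

theorem IsSumSq.exists_list {R : Type*} [CommRing R] {a : R} (ha : IsSumSq a) :
    ∃ l : List R, a = (l.map (· ^ 2)).sum := by
  induction ha with
  | zero => exact ⟨[], rfl⟩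
  | sq_add a _ ih =>
    obtain ⟨l, rfl⟩ := ih
    exact ⟨a :: l, by simp [sq]⟩

theorem isSumSq_list_sum_sq {R : Type*} [CommRing R] (l : List R) :
    IsSumSq (l.map (· ^ 2)).sum := by
  induction l with
  | nil => exact .zero
  | cons a l ih => simpa [sq] using IsSumSq.sq_add a ih

theorem IsSumSq.map {R S : Type*} [CommRing R] [CommRing S] (f : R →+* S) {a : R}
    (ha : IsSumSq a) : IsSumSq (f a) := by
  induction ha with
  | zero => simp
  | sq_add a _ ih => simpa using IsSumSq.sq_add (f a) ih

theorem sq_le_map_list_sum_sq {R : Type*} [CommRing R] (ψ : R →+* ℝ) {l : List R} {q : R}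
    (hq : q ∈ l) : ψ q ^ 2 ≤ ψ (l.map (· ^ 2)).sum := by
  rw [map_list_sum, List.map_map]
  exact List.single_le_sum (by simp [sq_nonneg]) _ (List.mem_map.2 ⟨q, hq, by simp⟩)

/-- At a real zero of `p` the whole sum vanishes, and `q²` is at most the sum, so `q` vanishes there
too. -/
theorem IsRealIrreducible.dvd_of_dvd_sum_sq {n : ℕ} {p : MvPolynomial (Fin n) ℝ}
    (hp : IsRealIrreducible p) {l : List (MvPolynomial (Fin n) ℝ)}
    (hl : p ∣ (l.map (· ^ 2)).sum) {q : MvPolynomial (Fin n) ℝ} (hq : q ∈ l) : p ∣ q := by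
  refine hp.dvd_of_eval_eq_zero fun x hx => ?_
  have h1 := sq_le_map_list_sum_sq (MvPolynomial.eval x) hq
  obtain ⟨r, hr⟩ := hl
  rw [hr, map_mul, hx, zero_mul] at h1
  exact pow_eq_zero_iff two_ne_zero |>.1 (le_antisymm h1 (sq_nonneg _))

/-- `h` is nonzero, and squares of `h` can be cancelled from sums of squares. -/
def CancelsSumSq {R : Type*} [CommRing R] (h : R) : Prop :=
  h ≠ 0 ∧ ∀ P, IsSumSq (h ^ 2 * P) → IsSumSq P

theorem CancelsSumSq.one {R : Type*} [CommRing R] [Nontrivial R] : CancelsSumSq (1 : R) :=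
  ⟨one_ne_zero, fun P hP => by simpa using hP⟩

theorem CancelsSumSq.mul {R : Type*} [CommRing R] [IsDomain R] {a b : R} (ha : CancelsSumSq a)
    (hb : CancelsSumSq b) : CancelsSumSq (a * b) :=
  ⟨mul_ne_zero ha.1 hb.1, fun P hP => hb.2 P (ha.2 _ (by rwa [← mul_assoc, ← mul_pow]))⟩

theorem CancelsSumSq.pow {R : Type*} [CommRing R] [IsDomain R] {a : R} (ha : CancelsSumSq a)
    (k : ℕ) : CancelsSumSq (a ^ k) := by
  induction k with
  | zero => simpa using CancelsSumSq.one
  | succ k ih => simpa [pow_succ] using ih.mul ha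

theorem IsRealIrreducible.cancelsSumSq {n : ℕ} {p : MvPolynomial (Fin n) ℝ}
    (hp : IsRealIrreducible p) : CancelsSumSq p := by
  refine ⟨hp.1.ne_zero, fun P hP => ?_⟩
  obtain ⟨l, hl⟩ := hP.exists_list
  have hd : ∀ q ∈ l, p ∣ q := fun q hq =>
    hp.dvd_of_dvd_sum_sq (hl ▸ ⟨p * P, by ring⟩) hq
  have : ∀ l : List (MvPolynomial (Fin n) ℝ), (∀ q ∈ l, p ∣ q) →
      ∃ l' : List (MvPolynomial (Fin n) ℝ),
        (l.map (· ^ 2)).sum = p ^ 2 * (l'.map (· ^ 2)).sum := by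
    intro l hl
    induction l with
    | nil => exact ⟨[], by simp⟩
    | cons q l ih =>
      obtain ⟨r, rfl⟩ := hl q (by simp)
      obtain ⟨l', hl'⟩ := ih fun q hq => hl q (by simp [hq])
      exact ⟨r :: l', by simp [hl', mul_add, mul_pow]⟩
  obtain ⟨l', hl'⟩ := this l hd
  rw [hl'] at hl
  rw [mul_left_cancel₀ (pow_ne_zero 2 hp.1.ne_zero) hl]
  exact isSumSq_list_sum_sq l'

theorem cancelsSumSq_multiset_prod {n : ℕ} (s : Multiset (MvPolynomial (Fin n) ℝ))
    (hs : ∀ p ∈ s, IsRealIrreducible p) : CancelsSumSq s.prod := by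
  induction s using Multiset.induction with
  | empty => simpa using CancelsSumSq.one
  | cons p s ih =>
    rw [Multiset.prod_cons]
    exact (hs p (by simp)).cancelsSumSq.mul (ih fun q hq => hs q (by simp [hq]))

theorem IsSumSq.exists_algebraMap_eq {R : Type*} [CommRing R] {h : R}
    {f : Localization.Away h} (hf : IsSumSq f) :
    ∃ (m : ℕ) (Q : R), IsSumSq Q ∧
      algebraMap R (Localization.Away h) Q = algebraMap R _ (h ^ m) ^ 2 * f := by
  induction hf with
  | zero => exact ⟨0, 0, .zero, by simp⟩
  | sq_add a _ ih =>
    obtain ⟨m, Q, hQ, e⟩ := ih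
    obtain ⟨k, b, hb⟩ := IsLocalization.Away.surj h a
    refine ⟨m + k, (h ^ m * b) * (h ^ m * b) + (h ^ k * h ^ k) * Q,
      .sq_add _ ((IsSumSq.mul_self _).mul hQ), ?_⟩
    rw [map_add, map_mul (algebraMap R (Localization.Away h)) (h ^ k * h ^ k), e]
    simp only [map_mul, map_pow, ← hb]
    ring

/-- A common denominator of the summands enters squared, so `h ^ (2m) * P` is a sum of squares in
`R`, and the even power cancels. -/
theorem CancelsSumSq.isSumSq_algebraMap_iff {R : Type*} [CommRing R] [IsDomain R] {h : R}
    (hh : CancelsSumSq h) (P : R) :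
    IsSumSq (algebraMap R (Localization.Away h) P) ↔ IsSumSq P := by
  refine ⟨fun hP => ?_, fun hP => hP.map _⟩
  obtain ⟨m, Q, hQ, e⟩ := hP.exists_algebraMap_eq
  have hinj : Function.Injective (algebraMap R (Localization.Away h)) :=
    IsLocalization.injective _ (powers_le_nonZeroDivisors_of_noZeroDivisors hh.1)
  rw [← map_pow, ← map_mul] at e
  exact (hh.pow m).2 P (hinj e ▸ hQ)

/-! ### The finest locally convex topology in countable dimension. -/

/-- Around a point of a set that is open on finite-dimensional subspaces, a box in the first `m`
coordinates inside the set can be extended to a box in the first `m + 1` coordinates. -/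
theorem exists_pos_forall_add_smul_mem {E : Type*} [AddCommGroup E] [Module ℝ E] {U : Set E}
    {x : E} {e : ℕ → E} {m : ℕ}
    (hU : IsOpen {a : ℕ → ℝ | x + ∑ k ∈ Finset.range (m + 1), a k • e k ∈ U}) {ε : ℕ → ℝ}
    (hpos : ∀ k, 0 < ε k)
    (hε : ∀ a : ℕ → ℝ, (∀ k < m, |a k| ≤ ε k) → x + ∑ k ∈ Finset.range m, a k • e k ∈ U) :
    ∃ δ > 0, ∀ a : ℕ → ℝ, (∀ k < m, |a k| ≤ ε k) → |a m| ≤ δ →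
      x + ∑ k ∈ Finset.range (m + 1), a k • e k ∈ U := by
  let K : Set (ℕ → ℝ) := Set.pi Set.univ fun k => Set.Icc (-ε k) (ε k)
  have hK : IsCompact K := isCompact_univ_pi fun k => isCompact_Icc
  let φ : (ℕ → ℝ) × ℝ → ℕ → ℝ := fun q => Function.update q.1 m q.2
  have hφ : Continuous φ := continuous_fst.update m continuous_snd
  -- With last coordinate `0` the compact box lies in the open set by `hε`; the tube lemma then
  -- thickens it in direction `m`.
  have hsub : K ×ˢ {(0 : ℝ)} ⊆ φ ⁻¹' {a | x + ∑ k ∈ Finset.range (m + 1), a k • e k ∈ U} := by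
    rintro ⟨a, t⟩ ⟨ha, rfl : t = 0⟩
    have := hε a fun k _ => abs_le.2 (ha k trivial)
    simp only [Set.mem_preimage, Set.mem_ofPred_eq, φ, Finset.sum_range_succ,
      Function.update_self, zero_smul, add_zero]
    convert this using 3 with k hk
    rw [Function.update_of_ne (Finset.mem_range.1 hk).ne]
  obtain ⟨V, W, -, hW, hKV, h0W, hVW⟩ :=
    generalized_tube_lemma hK isCompact_singleton (hU.preimage hφ) hsub
  obtain ⟨δ, hδ, hball⟩ := Metric.isOpen_iff.1 hW 0 (h0W rfl)
  refine ⟨δ / 2, by positivity, fun a ha ham => ?_⟩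
  -- `K` bounds every coordinate but `a` is controlled only below `m`; the later coordinates do not
  -- enter the sum and are set to `0`.
  let a' : ℕ → ℝ := fun k => if k < m then a k else 0
  have ha' : a' ∈ K := fun k _ => by
    simp only [a']
    split_ifs with h
    · exact abs_le.1 (ha k h)
    · exact ⟨by linarith [hpos k], (hpos k).le⟩
  have hmem := hVW (show (a', a m) ∈ V ×ˢ W from ⟨hKV ha', hball (by
    rw [mem_ball_zero_iff, Real.norm_eq_abs]; linarith)⟩)
  simp only [Set.mem_preimage, Set.mem_ofPred_eq, φ] at hmem
  convert hmem using 3 with k hk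
  rcases (Nat.lt_succ_iff_lt_or_eq.1 (Finset.mem_range.1 hk)) with h | rfl
  · rw [Function.update_of_ne h.ne]
    simp [a', h]
  · simp

/-- Side lengths are chosen one at a time, never changing earlier ones. The side in direction `k` is
fixed from stage `k + 1` on, so the stages fit into a single sequence valid for all `m`. -/
theorem exists_pos_box_mem {E : Type*} [AddCommGroup E] [Module ℝ E] {U : Set E}
    {x : E} {e : ℕ → E} (hx : x ∈ U)
    (hU : ∀ m, IsOpen {a : ℕ → ℝ | x + ∑ k ∈ Finset.range m, a k • e k ∈ U}) :
    ∃ ε : ℕ → ℝ, (∀ k, 0 < ε k) ∧ ∀ (m : ℕ) (a : ℕ → ℝ), (∀ k, |a k| ≤ ε k) →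
      x + ∑ k ∈ Finset.range m, a k • e k ∈ U := by
  let Good (m : ℕ) (ε : ℕ → ℝ) : Prop := (∀ k, 0 < ε k) ∧
    ∀ a : ℕ → ℝ, (∀ k < m, |a k| ≤ ε k) → x + ∑ k ∈ Finset.range m, a k • e k ∈ U
  have step (m : ℕ) (ε : {ε // Good m ε}) :
      ∃ ε' : {ε // Good (m + 1) ε}, ∀ k < m, ε'.1 k = ε.1 k := by
    obtain ⟨δ, hδ, h⟩ := exists_pos_forall_add_smul_mem (hU (m + 1)) ε.2.1 ε.2.2
    refine ⟨⟨Function.update ε.1 m δ, fun k => ?_, fun a ha => ?_⟩, fun k hk =>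
      Function.update_of_ne hk.ne _ _⟩
    · rcases eq_or_ne k m with rfl | hk
      · simpa using hδ
      · simpa [Function.update_of_ne hk] using ε.2.1 k
    · refine h a (fun k hk => ?_) ?_
      · simpa [Function.update_of_ne hk.ne] using ha k (by omega)
      · simpa using ha m (by omega)
  choose S hS using step
  let F : (m : ℕ) → {ε // Good m ε} := fun m =>
    Nat.rec ⟨fun _ => 1, fun _ => one_pos, fun a _ => by simpa using hx⟩ S m
  have hF (k j : ℕ) : (F (k + 1 + j)).1 k = (F (k + 1)).1 k := by
    induction j with
    | zero => rfl
    | succ j ih => exact (hS (k + 1 + j) (F _) k (by omega)).trans ih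
  refine ⟨fun k => (F (k + 1)).1 k, fun k => (F (k + 1)).2.1 k, fun m a ha => ?_⟩
  refine (F m).2.2 a fun k hk => ?_
  obtain ⟨j, rfl⟩ := Nat.exists_eq_add_of_lt hk
  rw [show k + j + 1 = k + 1 + j by ring, hF]
  exact ha k

/-- The weighted `ℓ¹` seminorm with respect to a basis. -/
noncomputable def weightedSeminorm {ι E : Type*} [AddCommGroup E] [Module ℝ E]
    (b : Module.Basis ι ℝ E) (c : ι → ℝ) (hc : ∀ i, 0 ≤ c i) : Seminorm ℝ E :=
  Seminorm.of (fun y => ∑ i ∈ (b.repr y).support, c i * |b.repr y i|)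
    (fun y z => by
      classical
      let T := (b.repr y).support ∪ (b.repr z).support ∪ (b.repr (y + z)).support
      have key (w : E) (hw : (b.repr w).support ⊆ T) :
          ∑ i ∈ (b.repr w).support, c i * |b.repr w i| = ∑ i ∈ T, c i * |b.repr w i| :=
        Finset.sum_subset hw fun i _ hi => by simp [Finsupp.notMem_support_iff.1 hi]
      rw [key y fun i hi => by simp only [T, Finset.mem_union]; tauto,
        key z fun i hi => by simp only [T, Finset.mem_union]; tauto,
        key (y + z) fun i hi => by simp only [T, Finset.mem_union]; tauto,
        ← Finset.sum_add_distrib]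
      refine Finset.sum_le_sum fun i _ => ?_
      rw [map_add, Finsupp.add_apply, ← mul_add]
      exact mul_le_mul_of_nonneg_left (abs_add_le _ _) (hc i))
    (fun r y => by
      rcases eq_or_ne r 0 with rfl | hr
      · simp
      · rw [map_smul, Finsupp.support_smul_eq hr, Finset.mul_sum]
        refine Finset.sum_congr rfl fun i _ => ?_
        rw [Finsupp.smul_apply, smul_eq_mul, abs_mul, Real.norm_eq_abs]
        ring)

theorem weightedSeminorm_apply {ι E : Type*} [AddCommGroup E] [Module ℝ E]
    (b : Module.Basis ι ℝ E) (c : ι → ℝ) (hc : ∀ i, 0 ≤ c i) (y : E) :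
    weightedSeminorm b c hc y = ∑ i ∈ (b.repr y).support, c i * |b.repr y i| := rfl

theorem mul_abs_repr_le_weightedSeminorm {ι E : Type*} [AddCommGroup E] [Module ℝ E]
    (b : Module.Basis ι ℝ E) (c : ι → ℝ) (hc : ∀ i, 0 ≤ c i) (y : E) (i : ι) :
    c i * |b.repr y i| ≤ weightedSeminorm b c hc y := by
  have hnn : ∀ j ∈ (b.repr y).support, 0 ≤ c j * |b.repr y j| := fun j _ =>
    mul_nonneg (hc j) (abs_nonneg _)
  rw [weightedSeminorm_apply]
  by_cases hi : i ∈ (b.repr y).support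
  · exact Finset.single_le_sum hnn hi
  · rw [Finsupp.notMem_support_iff.1 hi]
    simpa using Finset.sum_nonneg hnn

/-- The topology defined by `p` is one of those in the infimum, so its balls are neighbourhoods in
the finest one. -/
theorem mem_nhds_finestLocallyConvexTopology {E : Type*} [AddCommGroup E] [Module ℝ E]
    (p : Seminorm ℝ E) (x : E) {U : Set E} (hU : ∀ y, p (y - x) < 1 → y ∈ U) :
    U ∈ @nhds E (finestLocallyConvexTopology E) x := by
  let G : SeminormedAddCommGroup E := p.toAddGroupSeminorm.toSeminormedAddCommGroup
  let N : NormedSpace ℝ E := ⟨fun a y => (map_smul_eq_mul p a y).le⟩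
  let t : TopologicalSpace E := G.toPseudoMetricSpace.toUniformSpace.toTopologicalSpace
  have ht : finestLocallyConvexTopology E ≤ t :=
    sInf_le ⟨inferInstance, inferInstance, inferInstance⟩
  refine nhds_mono ht ?_
  filter_upwards [Metric.ball_mem_nhds x one_pos] with y hy
  exact hU y (by rwa [mem_ball_iff_norm] at hy)

/-- In a space of countable dimension, a set is closed in the finest locally convex topology as
soon as its trace on every finitely parametrized affine subspace is closed. -/
theorem isClosed_finestLocallyConvexTopology {ι E : Type*} [AddCommGroup E] [Module ℝ E]
    [Countable ι] (b : Module.Basis ι ℝ E) {C : Set E}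
    (hC : ∀ (x : E) (e : ℕ → E) (m : ℕ),
      IsClosed {a : ℕ → ℝ | x + ∑ k ∈ Finset.range m, a k • e k ∈ C}) :
    IsClosed[finestLocallyConvexTopology E] C := by
  rw [← @isOpen_compl_iff, @isOpen_iff_mem_nhds]
  intro x hx
  obtain ⟨f, hf⟩ := exists_injective_nat ι
  let e : ℕ → E := Function.extend f b 0
  obtain ⟨ε, hε, hbox⟩ := exists_pos_box_mem (e := e) hx fun m => (hC x e m).isOpen_compl
  -- With weights inverse to the sides, seminorm less than `1` forces every coordinate of `y - x`
  -- into the box.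
  refine mem_nhds_finestLocallyConvexTopology
    (weightedSeminorm b (fun i => (ε (f i))⁻¹) fun i => (inv_pos.2 (hε _)).le) x fun y hy => ?_
  have hcoord (i : ι) : |b.repr (y - x) i| ≤ ε (f i) := by
    have h1 := (mul_abs_repr_le_weightedSeminorm b (fun i => (ε (f i))⁻¹)
      (fun i => (inv_pos.2 (hε _)).le) (y - x) i).trans hy.le
    rwa [inv_mul_le_iff₀ (hε _), mul_one] at h1
  let a : ℕ → ℝ := Function.extend f (b.repr (y - x)) 0
  have ha (k : ℕ) : |a k| ≤ ε k := by
    by_cases hk : ∃ i, f i = k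
    · obtain ⟨i, rfl⟩ := hk
      simpa [a, hf.extend_apply] using hcoord i
    · simpa [a, Function.extend_apply' _ _ _ hk] using (hε k).le
  have hsum : ∑ k ∈ (b.repr (y - x)).support.image f, a k • e k = y - x := by
    rw [Finset.sum_image hf.injOn]
    simp only [a, e, hf.extend_apply]
    exact b.linearCombination_repr (y - x)
  obtain ⟨m, hm⟩ := Finset.exists_nat_subset_range ((b.repr (y - x)).support.image f)
  have := hbox m a ha
  rw [← Finset.sum_subset hm, hsum, add_sub_cancel] at this
  · exact this
  · intro k _ hk
    by_cases hk' : ∃ i, f i = k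
    · obtain ⟨i, rfl⟩ := hk'
      have : b.repr (y - x) i = 0 := by
        by_contra h0
        exact hk (Finset.mem_image_of_mem f (Finsupp.mem_support_iff.2 h0))
      simp only [a, hf.extend_apply, this, zero_smul]
    · simp [a, Function.extend_apply' _ _ _ hk']

theorem exists_countable_basis (B : Type*) [CommRing B] [Algebra ℝ B] [Algebra.FiniteType ℝ B] :
    ∃ ι : Type, Countable ι ∧ Nonempty (Module.Basis ι ℝ B) := by
  obtain ⟨m, φ, hφ⟩ := Algebra.FiniteType.iff_quotient_mvPolynomial''.1
    (inferInstance : Algebra.FiniteType ℝ B)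
  let v : (Fin m →₀ ℕ) → B := fun d => φ (MvPolynomial.monomial d 1)
  have hv : Submodule.span ℝ (Set.range v) = ⊤ := by
    have h1 : Set.range v = φ.toLinearMap '' Set.range (MvPolynomial.basisMonomials (Fin m) ℝ) := by
      rw [← Set.range_comp]
      rfl
    rw [h1, Submodule.span_image, Module.Basis.span_eq, Submodule.map_top]
    exact LinearMap.range_eq_top.2 hφ
  obtain ⟨κ, a, ha, hspan, hli⟩ := exists_linearIndependent' ℝ v
  exact ⟨κ, ha.countable, ⟨Module.Basis.mk hli (by rw [hspan, hv])⟩⟩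

/-! ### Degree bounds for the summands of a sum of squares. -/

theorem Polynomial.two_mul_natDegree_le_of_sq_le {Q P : Polynomial ℝ}
    (h : ∀ t, Q.eval t ^ 2 ≤ P.eval t) : 2 * Q.natDegree ≤ P.natDegree := by
  by_contra! hlt
  have hQ : Q ≠ 0 := by
    rintro rfl
    simp at hlt
  have hdeg : P.degree < (Q ^ 2).degree :=
    Polynomial.degree_lt_degree (by rwa [Polynomial.natDegree_pow])
  have h0 := Polynomial.div_tendsto_atTop_zero_of_degree_lt P (Q ^ 2) hdeg
  obtain ⟨t, ht1, ht2⟩ := ((h0.eventually_lt_const one_pos).and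
    (Polynomial.eventually_atTop_not_isRoot Q hQ)).exists
  have hpos : 0 < Q.eval t ^ 2 := by
    have : Q.eval t ≠ 0 := ht2
    positivity
  rw [Polynomial.eval_pow, div_lt_one hpos] at ht1
  exact absurd (h t) (not_le.2 ht1)

/-- The restriction `t ↦ q(t x)` of a polynomial to a line through the origin. -/
noncomputable def linePoly {n : ℕ} (x : Fin n → ℝ) : MvPolynomial (Fin n) ℝ →ₐ[ℝ] Polynomial ℝ :=
  MvPolynomial.aeval fun i => Polynomial.C (x i) * Polynomial.X

theorem eval_linePoly {n : ℕ} (x : Fin n → ℝ) (q : MvPolynomial (Fin n) ℝ) (t : ℝ) :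
    (linePoly x q).eval t = MvPolynomial.eval (fun i => x i * t) q := by
  have : (Polynomial.evalRingHom t).comp (linePoly x).toRingHom =
      MvPolynomial.eval (fun i => x i * t) := by
    refine MvPolynomial.ringHom_ext (fun r => ?_) fun i => ?_ <;> simp [linePoly]
  exact congrArg (fun f => f q) this

theorem linePoly_monomial {n : ℕ} (x : Fin n → ℝ) (d : Fin n →₀ ℕ) (r : ℝ) :
    linePoly x (MvPolynomial.monomial d r) =
      Polynomial.C (MvPolynomial.eval x (MvPolynomial.monomial d r)) *
        Polynomial.X ^ d.degree := by
  rw [linePoly, MvPolynomial.aeval_monomial, MvPolynomial.eval_monomial]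
  simp only [Finsupp.prod, mul_pow, Finset.prod_mul_distrib, Finset.prod_pow_eq_pow_sum,
    Finsupp.degree_apply, map_mul, map_prod, map_pow, Polynomial.algebraMap_apply,
    Algebra.algebraMap_self, RingHom.id_apply]
  ring

theorem coeff_linePoly {n : ℕ} (x : Fin n → ℝ) (q : MvPolynomial (Fin n) ℝ) (k : ℕ) :
    (linePoly x q).coeff k = MvPolynomial.eval x (MvPolynomial.homogeneousComponent k q) := by
  induction q using MvPolynomial.induction_on' with
  | add p q hp hq => simp [hp, hq]
  | monomial d r =>
    rw [linePoly_monomial, Polynomial.coeff_C_mul_X_pow,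
      MvPolynomial.homogeneousComponent_of_mem (MvPolynomial.isHomogeneous_monomial r rfl)]
    split_ifs <;> simp

theorem natDegree_linePoly_le {n : ℕ} (x : Fin n → ℝ) (q : MvPolynomial (Fin n) ℝ) :
    (linePoly x q).natDegree ≤ q.totalDegree := by
  refine Polynomial.natDegree_le_iff_coeff_eq_zero.2 fun k hk => ?_
  rw [coeff_linePoly, MvPolynomial.homogeneousComponent_eq_zero _ _ hk, map_zero]

theorem MvPolynomial.homogeneousComponent_totalDegree_ne_zero {n : ℕ}
    {q : MvPolynomial (Fin n) ℝ} (hq : q ≠ 0) :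
    MvPolynomial.homogeneousComponent q.totalDegree q ≠ 0 := by
  obtain ⟨d, hd, h⟩ := Finset.exists_mem_eq_sup _ (MvPolynomial.support_nonempty.2 hq)
    fun d : Fin n →₀ ℕ => d.degree
  intro h0
  have h1 := congrArg (MvPolynomial.coeff d) h0
  have h2 : d.degree = q.totalDegree := h.symm
  rw [MvPolynomial.coeff_homogeneousComponent, if_pos h2] at h1
  exact MvPolynomial.mem_support_iff.1 hd h1

/-- On a line through the origin where the top form of `q` is nonzero, `q` keeps its degree and that
of `P` cannot rise, so growth in one variable decides. -/
theorem MvPolynomial.two_mul_totalDegree_le_of_sq_le {n : ℕ} {q P : MvPolynomial (Fin n) ℝ}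
    (h : ∀ x, MvPolynomial.eval x q ^ 2 ≤ MvPolynomial.eval x P) :
    2 * q.totalDegree ≤ P.totalDegree := by
  rcases eq_or_ne q 0 with rfl | hq
  · simp
  obtain ⟨x, hx⟩ : ∃ x, MvPolynomial.eval x
      (MvPolynomial.homogeneousComponent q.totalDegree q) ≠ 0 := by
    by_contra! h0
    exact MvPolynomial.homogeneousComponent_totalDegree_ne_zero hq
      (MvPolynomial.funext fun x => by rw [h0 x, map_zero])
  rw [← coeff_linePoly] at hx
  have h1 := Polynomial.two_mul_natDegree_le_of_sq_le (Q := linePoly x q) (P := linePoly x P)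
    fun t => by simpa only [eval_linePoly] using h _
  have h2 := Polynomial.le_natDegree_of_ne_zero hx
  have h3 := natDegree_linePoly_le x P
  omega

/-! ### Gram matrices and limits of sums of squares of bounded degree. -/

section Gram

variable {n : ℕ} {T : Finset (Fin n →₀ ℕ)}

open scoped MatrixOrder in
theorem Matrix.PosSemidef.exists_eq_sum_mul {ι : Type*} [Fintype ι] {G : Matrix ι ι ℝ}
    (hG : G.PosSemidef) : ∃ B : Matrix ι ι ℝ, ∀ i j, G i j = ∑ c, B c i * B c j := by
  classical
  obtain ⟨B, rfl⟩ := CStarAlgebra.nonneg_iff_eq_star_mul_self.mp hG.nonneg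
  exact ⟨B, fun i j => by simp [Matrix.mul_apply, Matrix.star_apply]⟩

theorem Matrix.PosSemidef.abs_apply_le_trace {ι : Type*} [Fintype ι] {G : Matrix ι ι ℝ}
    (hG : G.PosSemidef) (i j : ι) : |G i j| ≤ G.trace := by
  have hle (k : ι) : G k k ≤ G.trace :=
    Finset.single_le_sum (f := fun k => G k k) (fun k _ => hG.diag_nonneg) (Finset.mem_univ k)
  obtain ⟨B, hB⟩ := hG.exists_eq_sum_mul
  have h1 : |G i j| ≤ ∑ c, (B c i * B c i + B c j * B c j) / 2 := by
    rw [hB]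
    refine (Finset.abs_sum_le_sum_abs _ _).trans (Finset.sum_le_sum fun c _ => ?_)
    rw [abs_le]
    constructor <;> nlinarith [sq_nonneg (B c i + B c j), sq_nonneg (B c i - B c j)]
  rw [← Finset.sum_div, Finset.sum_add_distrib, ← hB, ← hB] at h1
  linarith [hle i, hle j]

theorem Matrix.isClosed_posSemidef {ι : Type*} [Fintype ι] :
    IsClosed {G : Matrix ι ι ℝ | G.PosSemidef} := by
  simp only [Matrix.posSemidef_iff_dotProduct_mulVec, Matrix.IsHermitian, Set.ofPred_and,
    Set.ofPred_forall]
  refine (isClosed_eq (by fun_prop) (by fun_prop)).inter (isClosed_iInter fun x => ?_)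
  exact isClosed_le (by fun_prop) (by fun_prop)

/-- The polynomial `∑ cᵢ x^i`. -/
noncomputable def coeffPoly (c : T → ℝ) : MvPolynomial (Fin n) ℝ :=
  ∑ i, MvPolynomial.monomial i.1 (c i)

theorem coeff_coeffPoly (c : T → ℝ) (i : T) : MvPolynomial.coeff i.1 (coeffPoly c) = c i := by
  classical
  simp only [coeffPoly, MvPolynomial.coeff_sum, MvPolynomial.coeff_monomial]
  rw [Finset.sum_eq_single i]
  · simp
  · intro j _ hj
    simp [Subtype.val_injective.ne hj]
  · simp

theorem exists_eq_coeffPoly {q : MvPolynomial (Fin n) ℝ} (hq : q.support ⊆ T) :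
    ∃ c : T → ℝ, q = coeffPoly c := by
  refine ⟨fun i => q.coeff i.1, ?_⟩
  rw [coeffPoly, Finset.sum_coe_sort T fun i => MvPolynomial.monomial i (q.coeff i)]
  conv_lhs => rw [q.as_sum]
  exact Finset.sum_subset hq fun i _ hi => by simp [MvPolynomial.notMem_support_iff.1 hi]

/-- The polynomial with Gram matrix `G`. -/
noncomputable def gramPoly (G : Matrix T T ℝ) : MvPolynomial (Fin n) ℝ :=
  ∑ i, ∑ j, MvPolynomial.monomial (i.1 + j.1) (G i j)

theorem gramPoly_add (G H : Matrix T T ℝ) : gramPoly (G + H) = gramPoly G + gramPoly H := by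
  simp [gramPoly, Finset.sum_add_distrib]

theorem gramPoly_smul (r : ℝ) (G : Matrix T T ℝ) : gramPoly (r • G) = r • gramPoly G := by
  simp [gramPoly, Finset.smul_sum, MvPolynomial.smul_monomial]

theorem gramPoly_vecMulVec (c : T → ℝ) : gramPoly (Matrix.vecMulVec c c) = coeffPoly c ^ 2 := by
  simp [gramPoly, coeffPoly, sq, Finset.sum_mul_sum, Matrix.vecMulVec_apply]

theorem gramPoly_eq_sum_sq {G B : Matrix T T ℝ} (hB : ∀ i j, G i j = ∑ c, B c i * B c j) :
    gramPoly G = ∑ c, coeffPoly (B c) * coeffPoly (B c) := by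
  have : G = ∑ c, Matrix.vecMulVec (B c) (B c) := by
    ext i j
    rw [hB, Matrix.sum_apply]
    rfl
  simp only [this, ← sq, ← gramPoly_vecMulVec]
  exact map_sum (AddMonoidHom.mk' (gramPoly (T := T)) gramPoly_add) _ _

theorem Matrix.PosSemidef.isSumSq_gramPoly {G : Matrix T T ℝ} (hG : G.PosSemidef) :
    IsSumSq (gramPoly G) := by
  obtain ⟨B, hB⟩ := hG.exists_eq_sum_mul
  rw [gramPoly_eq_sum_sq hB]
  exact IsSumSq.sum_mul_self _ _

/-- A vanishing sum of real squares has vanishing terms, so every row of the factor `B` is zero.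
This keeps normalized Gram matrices from degenerating in the limit. -/
theorem Matrix.PosSemidef.trace_eq_zero_of_gramPoly_eq_zero {G : Matrix T T ℝ}
    (hG : G.PosSemidef) (h0 : ∀ x, MvPolynomial.eval x (gramPoly G) = 0) : G.trace = 0 := by
  obtain ⟨B, hB⟩ := hG.exists_eq_sum_mul
  simp only [gramPoly_eq_sum_sq hB, map_sum, map_mul] at h0
  have hq (c : T) : coeffPoly (B c) = 0 := MvPolynomial.funext fun x => by
    have := (Finset.sum_eq_zero_iff_of_nonneg fun c _ => mul_self_nonneg _).1 (h0 x) c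
      (Finset.mem_univ c)
    simpa using this
  refine Finset.sum_eq_zero fun i _ => ?_
  rw [Matrix.diag_apply, hB]
  refine Finset.sum_eq_zero fun c _ => ?_
  rw [← coeff_coeffPoly (B c) i, hq c]
  simp

theorem exists_posSemidef_list_sum_sq (l : List (MvPolynomial (Fin n) ℝ))
    (hl : ∀ q ∈ l, q.support ⊆ T) :
    ∃ G : Matrix T T ℝ, G.PosSemidef ∧ gramPoly G = (l.map (· ^ 2)).sum := by
  induction l with
  | nil => exact ⟨0, .zero, by simp [gramPoly]⟩
  | cons q l ih =>
    obtain ⟨G, hG, hGl⟩ := ih fun q hq => hl q (by simp [hq])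
    obtain ⟨c, rfl⟩ := exists_eq_coeffPoly (hl q (by simp))
    refine ⟨Matrix.vecMulVec c c + G, .add ?_ hG, ?_⟩
    · simpa using Matrix.posSemidef_vecMulVec_self_star c
    · simp [gramPoly_add, gramPoly_vecMulVec, hGl]

theorem IsSumSq.exists_posSemidef_gramPoly_eq {P : MvPolynomial (Fin n) ℝ} (hP : IsSumSq P)
    {D : ℕ} (hD : P.totalDegree ≤ 2 * D) (hT : ∀ d : Fin n →₀ ℕ, d.degree ≤ D → d ∈ T) :
    ∃ G : Matrix T T ℝ, G.PosSemidef ∧ gramPoly G = P := by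
  obtain ⟨l, rfl⟩ := hP.exists_list
  refine exists_posSemidef_list_sum_sq l fun q hq d hd => hT d ?_
  have h1 := MvPolynomial.two_mul_totalDegree_le_of_sq_le
    fun x => sq_le_map_list_sum_sq (MvPolynomial.eval x) hq
  have h2 : d.degree ≤ q.totalDegree := MvPolynomial.le_totalDegree hd
  omega

theorem continuous_eval_gramPoly (x : Fin n → ℝ) :
    Continuous fun G : Matrix T T ℝ => MvPolynomial.eval x (gramPoly G) := by
  simp only [gramPoly, map_sum, MvPolynomial.eval_monomial]
  fun_prop

/-- The compact set of positive semidefinite matrices `G` and numbers `s ≥ 0` with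
`tr G + s = 1`. -/
theorem isCompact_posSemidef_trace_add_eq_one {ι : Type*} [Fintype ι] :
    IsCompact {g : Matrix ι ι ℝ × ℝ | g.1.PosSemidef ∧ 0 ≤ g.2 ∧ g.1.trace + g.2 = 1} := by
  have hK : IsCompact (Set.pi Set.univ fun _ : ι => Set.pi Set.univ fun _ : ι =>
      Set.Icc (-1 : ℝ) 1) := isCompact_univ_pi fun _ => isCompact_univ_pi fun _ => isCompact_Icc
  refine (hK.prod (isCompact_Icc (a := (0 : ℝ)) (b := 1))).of_isClosed_subset ?_ ?_
  · exact (Matrix.isClosed_posSemidef.preimage continuous_fst).inter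
      ((isClosed_le continuous_const continuous_snd).inter
        (isClosed_eq (by fun_prop) continuous_const))
  · rintro ⟨G, s⟩ ⟨hG, hs, h1⟩
    have := hG.trace_nonneg
    refine ⟨fun i _ j _ => abs_le.1 ((hG.abs_apply_le_trace i j).trans ?_), hs, ?_⟩ <;>
      simp only at * <;> linarith

/-- Sums of squares of bounded degree are closed under pointwise limits. -/
theorem isSumSq_of_tendsto_eval {α : Type*} (U : Ultrafilter α)
    {P : α → MvPolynomial (Fin n) ℝ} {Q : MvPolynomial (Fin n) ℝ} {D : ℕ}
    (hP : ∀ᶠ a in U, IsSumSq (P a) ∧ (P a).totalDegree ≤ 2 * D)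
    (hQ : ∀ x, Filter.Tendsto (fun a => MvPolynomial.eval x (P a)) U
      (𝓝 (MvPolynomial.eval x Q))) : IsSumSq Q := by
  have hfin : {d : Fin n →₀ ℕ | d.degree ≤ D}.Finite := Finsupp.finite_of_degree_le D
  let T := hfin.toFinset
  have hex (a : α) : ∃ G : Matrix T T ℝ, G.PosSemidef ∧
      (IsSumSq (P a) ∧ (P a).totalDegree ≤ 2 * D → gramPoly G = P a) := by
    by_cases h : IsSumSq (P a) ∧ (P a).totalDegree ≤ 2 * D
    · obtain ⟨G, hG, e⟩ := h.1.exists_posSemidef_gramPoly_eq h.2 (T := T) (by simp [T])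
      exact ⟨G, hG, fun _ => e⟩
    · exact ⟨0, .zero, fun h' => absurd h' h⟩
  choose G hG hGP using hex
  -- The matrices `G a` need not be bounded a priori. Scaling `(G a, 1)` to total trace `1` gives a
  -- limit `(H, r)`, and `gramPoly H = r Q`.
  let s : α → ℝ := fun a => (1 + (G a).trace)⁻¹
  have hspos (a : α) : 0 < 1 + (G a).trace := by linarith [(hG a).trace_nonneg]
  obtain ⟨⟨H, r⟩, ⟨hH, hr, htr⟩, hlim⟩ :=
    isCompact_posSemidef_trace_add_eq_one.ultrafilter_le_nhds (U.map fun a => (s a • G a, s a)) (by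
      rw [Filter.le_principal_iff]
      refine Filter.mem_map.2 <| Filter.Eventually.of_forall fun a => ⟨(hG a).smul (inv_pos.2 (hspos a)).le,
        (inv_pos.2 (hspos a)).le, ?_⟩
      rw [Matrix.trace_smul, smul_eq_mul]
      have := hspos a
      simp only [s]
      field_simp
      ring)
  have hlim1 : Filter.Tendsto (fun a => s a • G a) U (𝓝 H) :=
    (continuous_fst.tendsto (H, r)).comp hlim
  have hlim2 : Filter.Tendsto s U (𝓝 r) := (continuous_snd.tendsto (H, r)).comp hlim
  have heval (x : Fin n → ℝ) :
      MvPolynomial.eval x (gramPoly H) = r * MvPolynomial.eval x Q := by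
    refine tendsto_nhds_unique (((continuous_eval_gramPoly x).tendsto H).comp hlim1)
      ((hlim2.mul (hQ x)).congr' ?_)
    filter_upwards [hP] with a ha
    rw [Function.comp_apply, gramPoly_smul, hGP a ha, MvPolynomial.smul_eval]
  -- If `r = 0`, then `gramPoly H = 0` forces `tr H = 0`, against `tr H + r = 1`.
  have hr0 : r ≠ 0 := by
    rintro rfl
    have := hH.trace_eq_zero_of_gramPoly_eq_zero fun x => by rw [heval, zero_mul]
    simp only [this] at htr
    norm_num at htr
  have : Q = gramPoly (r⁻¹ • H) := MvPolynomial.funext fun x => by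
    rw [gramPoly_smul, MvPolynomial.smul_eval, heval, inv_mul_cancel_left₀ hr0]
  rw [this]
  exact (hH.smul (inv_nonneg.2 hr)).isSumSq_gramPoly

end Gram

/-! ### Closedness of the cone of sums of squares. -/

theorem isClosed_setOf_isSumSq_add_sum {n : ℕ} (P : MvPolynomial (Fin n) ℝ)
    (e : ℕ → MvPolynomial (Fin n) ℝ) (m : ℕ) :
    IsClosed {a : ℕ → ℝ | IsSumSq (P + ∑ k ∈ Finset.range m, a k • e k)} := by
  refine isClosed_iff_ultrafilter.2 fun a U hU hmem => ?_
  refine isSumSq_of_tendsto_eval U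
    (P := fun a => P + ∑ k ∈ Finset.range m, a k • e k)
    (D := P.totalDegree + ∑ k ∈ Finset.range m, (e k).totalDegree) ?_ fun x => ?_
  · filter_upwards [hmem] with b hb
    refine ⟨hb, (MvPolynomial.totalDegree_add _ _).trans (max_le (by omega) ?_)⟩
    refine (MvPolynomial.totalDegree_finsetSum _ _).trans (Finset.sup_le fun k hk => ?_)
    have := Finset.single_le_sum (f := fun k => (e k).totalDegree) (fun _ _ => Nat.zero_le _) hk
    exact (MvPolynomial.totalDegree_smul_le _ _).trans (by omega)
  · have : Continuous fun a : ℕ → ℝ =>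
        MvPolynomial.eval x (P + ∑ k ∈ Finset.range m, a k • e k) := by
      simp only [map_add, map_sum, MvPolynomial.smul_eval]
      fun_prop
    exact (this.tendsto a).mono_left hU

theorem isSumSq_isUnit_sq_mul_iff {R : Type*} [CommRing R] {u : R} (hu : IsUnit u) (y : R) :
    IsSumSq (u ^ 2 * y) ↔ IsSumSq y := by
  obtain ⟨u, rfl⟩ := hu
  refine ⟨fun h => ?_, fun h => ?_⟩
  · have h1 := (IsSumSq.mul_self ((u⁻¹ : Rˣ) : R)).mul h
    rwa [← sq, ← mul_assoc, ← mul_pow, Units.inv_mul, one_pow, one_mul] at h1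
  · rw [sq]
    exact (IsSumSq.mul_self _).mul h

theorem CancelsSumSq.isClosed_sosCone {n : ℕ} {h : MvPolynomial (Fin n) ℝ}
    (hh : CancelsSumSq h) :
    IsClosed[finestLocallyConvexTopology (FractionAlgebra h)] (sosCone (FractionAlgebra h)) := by
  classical
  have : Algebra.FiniteType (MvPolynomial (Fin n) ℝ) (FractionAlgebra h) :=
    IsLocalization.finiteType_of_monoid_fg (Submonoid.powers h) _
  have : Algebra.FiniteType ℝ (FractionAlgebra h) :=
    Algebra.FiniteType.trans (S := MvPolynomial (Fin n) ℝ) inferInstance inferInstance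
  obtain ⟨ι, _, ⟨b⟩⟩ := exists_countable_basis (FractionAlgebra h)
  refine isClosed_finestLocallyConvexTopology b fun x e m => ?_
  obtain ⟨⟨g, hg⟩, hN⟩ := IsLocalization.exist_integer_multiples_of_finset
    (Submonoid.powers h) (insert x ((Finset.range m).image e))
  let u : FractionAlgebra h := algebraMap (MvPolynomial (Fin n) ℝ) _ g
  have hu : IsUnit u := IsLocalization.map_units (FractionAlgebra h) (⟨g, hg⟩ : Submonoid.powers h)
  have hex (y : FractionAlgebra h) : ∃ P : MvPolynomial (Fin n) ℝ,
      y ∈ insert x ((Finset.range m).image e) →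
        algebraMap (MvPolynomial (Fin n) ℝ) (FractionAlgebra h) P = u ^ 2 * y := by
    by_cases hy : y ∈ insert x ((Finset.range m).image e)
    · obtain ⟨P, hP⟩ := hN y hy
      -- The extra factor `g` makes the multiplier the square `u ^ 2`, which preserves being a sum
      -- of squares in both directions.
      refine ⟨g * P, fun _ => ?_⟩
      rw [map_mul, hP, Algebra.smul_def]
      ring
    · exact ⟨0, fun h => absurd h hy⟩
  choose P hP using hex
  convert isClosed_setOf_isSumSq_add_sum (P x) (fun k => P (e k)) m using 1
  ext a
  rw [Set.mem_ofPred_eq, Set.mem_ofPred_eq, ← hh.isSumSq_algebraMap_iff, map_add, map_sum,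
    hP x (Finset.mem_insert_self _ _)]
  have : ∑ k ∈ Finset.range m,
      algebraMap (MvPolynomial (Fin n) ℝ) (FractionAlgebra h) (a k • P (e k)) =
        u ^ 2 * ∑ k ∈ Finset.range m, a k • e k := by
    rw [Finset.mul_sum]
    refine Finset.sum_congr rfl fun k hk => ?_
    rw [Algebra.algebraMap_eq_smul_one, smul_assoc, ← Algebra.algebraMap_eq_smul_one, hP (e k)
      (Finset.mem_insert_of_mem (Finset.mem_image_of_mem e hk)), mul_smul_comm]
  rw [this, ← mul_add, isSumSq_isUnit_sq_mul_iff hu]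
  rfl

/-! ### The Motzkin polynomial. -/

/-- The Motzkin polynomial in `ℝ[x][y]`. -/
noncomputable def bivariateMotzkin : Polynomial (Polynomial ℝ) :=
  Polynomial.C (Polynomial.X ^ 4) * Polynomial.X ^ 2 +
    Polynomial.C (Polynomial.X ^ 2) * Polynomial.X ^ 4 -
    Polynomial.C (Polynomial.C 3 * Polynomial.X ^ 2) * Polynomial.X ^ 2 + 1

theorem coeff_natDegree_zero_of_sq_le_one {Q : Polynomial ℝ} (h : ∀ t, Q.eval t ^ 2 ≤ 1) {k : ℕ}
    (hk : k ≠ 0) : Q.coeff k = 0 := by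
  have := Polynomial.two_mul_natDegree_le_of_sq_le (Q := Q) (P := 1) (by simpa using h)
  rw [Polynomial.natDegree_one] at this
  exact Polynomial.coeff_eq_zero_of_natDegree_lt (by omega)

/-- Degree bounds leave `xy · xy` as the only product of monomials of a summand `F` contributing to
`x²y²` in `F²`. The coefficient of `x²y²` is then a sum of real squares, yet it is `-3`. -/
theorem not_isSumSq_bivariateMotzkin : ¬ IsSumSq bivariateMotzkin := by
  intro hsos
  obtain ⟨l, hl⟩ := hsos.exists_list
  have hle (a b : ℝ) {F} (hF : F ∈ l) : ((F.map (Polynomial.evalRingHom a)).eval b) ^ 2 ≤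
      a ^ 4 * b ^ 2 + a ^ 2 * b ^ 4 - 3 * a ^ 2 * b ^ 2 + 1 := by
    have h1 := sq_le_map_list_sum_sq
      ((Polynomial.evalRingHom b).comp (Polynomial.mapRingHom (Polynomial.evalRingHom a))) hF
    rw [← hl] at h1
    simpa [bivariateMotzkin] using h1
  -- On `y = 0` the Motzkin polynomial equals `1`, so `F(x, 0)` is constant; the next step uses `x =
  -- 0` in the same way.
  have hx {F} (hF : F ∈ l) {k : ℕ} (hk : k ≠ 0) : (F.coeff 0).coeff k = 0 := by
    refine coeff_natDegree_zero_of_sq_le_one (fun a => ?_) hk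
    have h1 := hle a 0 hF
    rw [← Polynomial.coeff_zero_eq_eval_zero, Polynomial.coeff_map] at h1
    simpa using h1
  have hy {F} (hF : F ∈ l) : (F.coeff 1).coeff 0 = 0 := by
    have h1 := coeff_natDegree_zero_of_sq_le_one (Q := F.map (Polynomial.evalRingHom 0))
      (fun b => by simpa using hle 0 b hF) one_ne_zero
    rwa [Polynomial.coeff_map, Polynomial.coe_evalRingHom,
      ← Polynomial.coeff_zero_eq_eval_zero] at h1
  have hdeg {F} (hF : F ∈ l) {k : ℕ} (hk : 2 < k) : F.coeff k = 0 := by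
    refine Polynomial.funext fun a => ?_
    let P : Polynomial ℝ := Polynomial.C (a ^ 4) * Polynomial.X ^ 2 +
      Polynomial.C (a ^ 2) * Polynomial.X ^ 4 -
      Polynomial.C (3 * a ^ 2) * Polynomial.X ^ 2 + 1
    have hP : P.natDegree ≤ 4 := by
      simp only [P]
      compute_degree
    have h1 := Polynomial.two_mul_natDegree_le_of_sq_le
      (Q := F.map (Polynomial.evalRingHom a)) (P := P) (fun b => by simpa [P] using hle a b hF)
    have h2 := Polynomial.coeff_eq_zero_of_natDegree_lt
      (show (F.map (Polynomial.evalRingHom a)).natDegree < k by omega)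
    simpa [Polynomial.coeff_map] using h2
  have hcoeff (k : ℕ) : bivariateMotzkin.coeff k = (l.map fun F => (F ^ 2).coeff k).sum := by
    have := congrArg (Polynomial.lcoeff (Polynomial ℝ) k) hl
    rw [map_list_sum, List.map_map] at this
    exact this
  have hsq4 {F} (hF : F ∈ l) : (F ^ 2).coeff 4 = F.coeff 2 ^ 2 := by
    rw [sq, Polynomial.coeff_mul]
    simp [Finset.Nat.antidiagonal_succ, hdeg hF, sq]
  -- Since `F` has degree at most `2` in `y`, comparing coefficients of `y⁴` gives `x² = ∑ F₂(x)²`;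
  -- hence `F₂` has degree at most `1`.
  have h22 {F} (hF : F ∈ l) : (F.coeff 2).coeff 2 = 0 := by
    have h4 := hcoeff 4
    rw [List.map_congr_left fun F hF => hsq4 hF] at h4
    have h5 : bivariateMotzkin.coeff 4 = Polynomial.X ^ 2 := by
      simp only [bivariateMotzkin, Polynomial.coeff_add, Polynomial.coeff_sub,
        Polynomial.coeff_C_mul, Polynomial.coeff_X_pow, Polynomial.coeff_one]
      norm_num
    have h6 := Polynomial.two_mul_natDegree_le_of_sq_le (Q := F.coeff 2) (P := Polynomial.X ^ 2)
      fun a => by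
        have h7 := sq_le_map_list_sum_sq (Polynomial.evalRingHom a)
          (l := l.map fun F => F.coeff 2) (List.mem_map_of_mem hF)
        rw [List.map_map] at h7
        rw [← h5, h4]
        exact h7
    rw [Polynomial.natDegree_X_pow] at h6
    exact Polynomial.coeff_eq_zero_of_natDegree_lt (by omega)
  have hsq2 {F} (hF : F ∈ l) : ((F ^ 2).coeff 2).coeff 2 = (F.coeff 1).coeff 1 ^ 2 := by
    rw [sq, Polynomial.coeff_mul]
    simp [Finset.Nat.antidiagonal_succ, Polynomial.coeff_mul, hx hF, hy hF, h22 hF, sq]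
  have h2 := congrArg (Polynomial.lcoeff ℝ 2) (hcoeff 2)
  rw [map_list_sum, List.map_map] at h2
  simp only [Function.comp_def, Polynomial.lcoeff_apply] at h2
  rw [List.map_congr_left fun F hF => hsq2 hF] at h2
  have h3 : (bivariateMotzkin.coeff 2).coeff 2 = -3 := by
    simp only [bivariateMotzkin, Polynomial.coeff_add, Polynomial.coeff_sub,
      Polynomial.coeff_C_mul, Polynomial.coeff_X_pow, Polynomial.coeff_one]
    norm_num [Polynomial.coeff_X_pow]
  have h4 : 0 ≤ (l.map fun F => (F.coeff 1).coeff 1 ^ 2).sum :=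
    List.sum_nonneg (by simp only [List.mem_map]; rintro _ ⟨F, -, rfl⟩; positivity)
  linarith

theorem not_isSumSq_motzkinPolynomial {n : ℕ} {i j : Fin n} (hij : i ≠ j) :
    ¬ IsSumSq (motzkinPolynomial i j) := by
  intro h
  let φ : MvPolynomial (Fin n) ℝ →ₐ[ℝ] Polynomial (Polynomial ℝ) :=
    MvPolynomial.aeval fun k =>
      if k = i then Polynomial.C Polynomial.X else if k = j then Polynomial.X else 0
  have e : φ (motzkinPolynomial i j) = bivariateMotzkin := by
    have h3 : Polynomial.C (Polynomial.C (3 : ℝ)) = 3 := by rw [map_ofNat, map_ofNat]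
    simp [φ, motzkinPolynomial, bivariateMotzkin, hij.symm, MvPolynomial.aeval_X, h3]
  exact not_isSumSq_bivariateMotzkin (e ▸ h.map φ.toRingHom)

theorem motzkin_nonneg (a b : ℝ) :
    0 ≤ a ^ 4 * b ^ 2 + a ^ 2 * b ^ 4 - 3 * a ^ 2 * b ^ 2 + 1 := by
  have hs := sq_nonneg a
  have ht := sq_nonneg b
  have hst : 0 ≤ a ^ 2 * b ^ 2 := mul_nonneg hs ht
  rcases le_total 3 (a ^ 2 + b ^ 2) with h | h
  · nlinarith [mul_nonneg hst (sub_nonneg.2 h)]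
  -- With `σ = a² + b²`, four times the polynomial is `(σ - 2)²(σ + 1) + (3 - σ)(a² - b²)²`.
  · have h1 : 0 ≤ (a ^ 2 + b ^ 2 - 2) ^ 2 * (a ^ 2 + b ^ 2 + 1) := by positivity
    have h2 := mul_nonneg (sub_nonneg.2 h) (sq_nonneg (a ^ 2 - b ^ 2))
    linarith

theorem algebraMap_motzkinPolynomial_mem_psdCone {n : ℕ} (h : MvPolynomial (Fin n) ℝ)
    (i j : Fin n) :
    algebraMap (MvPolynomial (Fin n) ℝ) (FractionAlgebra h) (motzkinPolynomial i j)
      ∈ psdCone (FractionAlgebra h) := by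
  intro χ
  let ψ : FractionAlgebra h →ₐ[ℝ] ℝ := χ
  have h1 := motzkin_nonneg (ψ (algebraMap (MvPolynomial (Fin n) ℝ) _ (MvPolynomial.X i)))
    (ψ (algebraMap (MvPolynomial (Fin n) ℝ) _ (MvPolynomial.X j)))
  change 0 ≤ ψ (algebraMap (MvPolynomial (Fin n) ℝ) _ (motzkinPolynomial i j))
  have h3 : ψ (algebraMap (MvPolynomial (Fin n) ℝ) _ 3) = 3 := by rw [map_ofNat, map_ofNat]
  simpa [motzkinPolynomial, h3] using h1

/-! ### Separation and failure of the moment property. -/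

/-- A closed sos cone that misses a positive semidefinite element excludes the moment property. -/
theorem not_hasMomentProperty_of_isClosed {B : Type*} [CommRing B] [Algebra ℝ B]
    (hcl : IsClosed[finestLocallyConvexTopology B] (sosCone B)) {f : B} (hf : f ∈ psdCone B)
    (hf' : f ∉ sosCone B) : ¬ HasMomentProperty B := by
  intro hmom
  let t : TopologicalSpace B := finestLocallyConvexTopology B
  have : IsTopologicalAddGroup B := topologicalAddGroup_sInf fun _ h => h.1
  have : ContinuousSMul ℝ B := continuousSMul_sInf fun _ h => h.2.1
  have : LocallyConvexSpace ℝ B := LocallyConvexSpace.sInf fun _ h => h.2.2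
  have hsmul {r : ℝ} (hr : 0 ≤ r) {g : B} (hg : IsSumSq g) : IsSumSq (r • g) := by
    have h1 := (IsSumSq.mul_self (algebraMap ℝ B (Real.sqrt r))).mul hg
    rwa [← map_mul, Real.mul_self_sqrt hr, ← Algebra.smul_def] at h1
  have hconv : Convex ℝ (sosCone B) := fun x hx y hy a b ha hb _ =>
    (hsmul ha hx).add (hsmul hb hy)
  obtain ⟨L, u, hfL, hL⟩ := geometric_hahn_banach_point_closed hconv hcl hf'
  have hu : u < 0 := by simpa using hL 0 .zero
  have hpos (g : B) (hg : IsSumSq g) : 0 ≤ L g := by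
    by_contra! hlt
    -- If `L g < 0`, this nonnegative multiple of `g` stays in the cone and has `L`-value exactly
    -- `u`, against the strict bound.
    have h1 := hL ((u / L g) • g) (hsmul (div_nonneg_of_nonpos hu.le hlt.le) hg)
    rw [map_smul, smul_eq_mul, div_mul_cancel₀ _ hlt.ne] at h1
    exact lt_irrefl _ h1
  obtain ⟨μ, -, -, hμ⟩ := hmom L.toLinearMap fun g => hpos _ (by rw [sq]; exact .mul_self g)
  have h1 : L f = _ := (hμ f).2
  have h2 : 0 ≤ ∫ χ : RealCharacter B, χ f ∂μ := MeasureTheory.integral_nonneg fun χ => hf χ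
  rw [← h1] at h2
  linarith

theorem mainTheorem3 (n : ℕ) (h : MvPolynomial (Fin n) ℝ)
    (hh : ∃ s : Multiset (MvPolynomial (Fin n) ℝ),
      (∀ p ∈ s, IsRealIrreducible p) ∧ h = s.prod) :
    IsClosed[finestLocallyConvexTopology (FractionAlgebra h)] (sosCone (FractionAlgebra h)) ∧
    (2 ≤ n →
      ¬ HasMomentProperty (FractionAlgebra h) ∧
      ∀ i j : Fin n, i ≠ j →
        algebraMap (MvPolynomial (Fin n) ℝ) (FractionAlgebra h) (motzkinPolynomial i j)
            ∈ psdCone (FractionAlgebra h) ∧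
        algebraMap (MvPolynomial (Fin n) ℝ) (FractionAlgebra h) (motzkinPolynomial i j)
            ∉ sosCone (FractionAlgebra h)) := by
  obtain ⟨s, hs, rfl⟩ := hh
  have hc := cancelsSumSq_multiset_prod s hs
  have hmot (i j : Fin n) (hij : i ≠ j) :
      algebraMap (MvPolynomial (Fin n) ℝ) (FractionAlgebra s.prod) (motzkinPolynomial i j)
        ∉ sosCone (FractionAlgebra s.prod) := fun hm =>
    not_isSumSq_motzkinPolynomial hij ((hc.isSumSq_algebraMap_iff _).1 hm)
  refine ⟨hc.isClosed_sosCone, fun hn => ⟨?_, fun i j hij =>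
    ⟨algebraMap_motzkinPolynomial_mem_psdCone _ i j, hmot i j hij⟩⟩⟩
  have hij : (⟨0, by omega⟩ : Fin n) ≠ ⟨1, by omega⟩ := by simp
  exact not_hasMomentProperty_of_isClosed hc.isClosed_sosCone
    (algebraMap_motzkinPolynomial_mem_psdCone _ _ _) (hmot _ _ hij)
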